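/- Let $\mathcal{A}$ be a finite alphabet and let $X\subseteq\mathcal{A}^{\mathbb{Z}}$ be a subshift, that is, a closed subset (for the product of the discrete topologies) that is invariant under the shift $\sigma$ and its inverse, where $(\sigma x)_i = x_{i+1}$; no minimality or transitivity is assumed. For $n\in\mathbb{N}$ let $P_X(n)$ be the number of words $w=(w_0,\dots,w_{n-1})\in\mathcal{A}^n$ for which there is $x\in X$ with $x_i=w_i$ for all $0\le i<n$, and let $\mathrm{Aut}(X)$ be the group of all homeomorphisms $\varphi\colon X\to X$ with $\varphi\circ\sigma=\sigma\circ\varphi$. Suppose that $$P_X(n) = o\left(\frac{n^2}{\log^2 n}\right)\qquad (n\to\infty).$$ Then $\mathrm{Aut}(X)$ is amenable as a countable discrete group: it is countable, and there is a sequence $(F_k)_{k\in\mathbb{N}}$ of finite subsets of $\mathrm{Aut}(X)$ such that every $g\in\mathrm{Aut}(X)$ lies in all but finitely many $F_k$ and $$\lim_{k\to\infty}\frac{|F_k\,\triangle\, gF_k|}{|F_k|}=0\qquad\text{for every } g\in\mathrm{Aut}(X).$$ -/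

import Mathlib

open Filter Topology Asymptotics
open scoped Pointwise symmDiff
open SymbolicDynamics.FullShift (Subshift shift)

/-- The left shift `(σ x)_i = x_{i+1}`, as a homeomorphism of a two-sided subshift `X`. -/
def shiftHomeo {A : Type*} [TopologicalSpace A] (X : Subshift A ℤ) : X.carrier ≃ₜ X.carrier where
  toFun x := ⟨shift 1 x.1, X.mapsTo 1 x.2⟩
  invFun x := ⟨shift (-1) x.1, X.mapsTo (-1) x.2⟩
  left_inv x := by
    ext i
    simp
  right_inv x := by
    ext i
    simp
  continuous_toFun := by fun_prop
  continuous_invFun := by fun_prop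

/-- `Aut(X)`: the centralizer of the shift in the group of all self-homeomorphisms of `X`. -/
def Aut {A : Type*} [TopologicalSpace A] (X : Subshift A ℤ) : Subgroup (X.carrier ≃ₜ X.carrier) :=
  Subgroup.centralizer {shiftHomeo X}

/-- The cylinder `[w]₀⁺` of the bi-infinite sequences that read `w` at positions `0, …, n - 1`. -/
def wordCylinder {A : Type*} {n : ℕ} (w : Fin n → A) : Set (ℤ → A) :=
  {x | ∀ i : Fin n, x ((i : ℕ) : ℤ) = w i}

/-- The set `L_n(X)` of words of length `n` in the language of `X`. -/
def languageOfLength {A : Type*} [TopologicalSpace A] (X : Subshift A ℤ) (n : ℕ) :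
    Set (Fin n → A) :=
  {w | (wordCylinder w ∩ X.carrier).Nonempty}

/-- The word complexity `P_X(n)`, the number of words of length `n` in the language of `X`. -/
noncomputable def complexity {A : Type*} [TopologicalSpace A] (X : Subshift A ℤ) (n : ℕ) : ℕ :=
  (languageOfLength X n).ncard

/-- `F` is a Følner sequence for the discrete group `G`: the `F k` are finite, every element of `G`
lies in all but finitely many of them, and `|F k ∆ g F k| / |F k| → 0` for every `g`. -/
structure IsFolnerSequence {G : Type*} [Group G] (F : ℕ → Set G) : Prop where
  finite : ∀ k, (F k).Finite
  eventually_mem : ∀ g : G, ∀ᶠ k in atTop, g ∈ F k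
  tendsto_zero : ∀ g : G,
    Tendsto (fun k => ((F k ∆ (g • F k)).ncard : ℝ) / ((F k).ncard : ℝ)) atTop (𝓝 0)

/-- Amenability of a countable discrete group: it has a Følner sequence. -/
def IsAmenable (G : Type*) [Group G] : Prop :=
  Countable G ∧ ∃ F : ℕ → Set G, IsFolnerSequence F

namespace SlowGrowth

variable {A : Type*} [TopologicalSpace A] {X : Subshift A ℤ}

/-! ### Translates and words -/

/-! Call an automorphism of range `m` if it and its inverse are sliding block codes of range `m`.
These finite sets exhaust the group and multiply with ranges adding, so it is enough that their
sizes are `exp (o(m))`: some ratio |range `m + k`| / |range `m`| is then close to 1, which yields a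
Følner sequence (`isAmenable_of_subexponential`).

To count them, choose `n` in `[4m, 5m)` with `P(n+1) - P(n) ≤ P(5m)/m`. Away from right special
words of length `n` the future of a point is forced. Hence an automorphism is determined by words of
length `n + 4m` in the images of a few test points (`eq_of_agree_on_testSet`): one for each
one-letter extension of a right special word, and one for each orbit of periodic points that meet no
right special word. There are at most `2 (P(n+1) - P(n))` extensions. The orbits are counted by
dyadic size of the period: there are `O(log m)` classes, each of size `o(m / log² m)`
(`ncard_representatives_le`).

So there are `o(m / log m)` test points, each with at most `P(n + 4m) ≤ m²` possible words, and the
count is `exp (o(m))`. One logarithm in the hypothesis pays for the dyadic classes, the other for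
`log (m²)`. -/

/-- The translate of a point of a subshift by an integer. -/
def translate (k : ℤ) (x : X.carrier) : X.carrier := ⟨shift k x.1, X.mapsTo k x.2⟩

@[simp]
lemma translate_apply (k : ℤ) (x : X.carrier) (i : ℤ) :
    (translate k x).1 i = x.1 (k + i) := rfl

lemma translate_translate (k l : ℤ) (x : X.carrier) :
    translate k (translate l x) = translate (l + k) x := by
  ext i
  simp [add_assoc]

@[simp]
lemma translate_zero (x : X.carrier) : translate 0 x = x := by
  ext i
  simp

/-- The word of length `n` read by `x` from position `i` on. -/
def wordAt (x : X.carrier) (i : ℤ) (n : ℕ) : Fin n → A := fun k => x.1 (i + (k : ℕ))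

lemma wordAt_mem (x : X.carrier) (i : ℤ) (n : ℕ) : wordAt x i n ∈ languageOfLength X n :=
  ⟨(translate i x).1, fun _ => rfl, (translate i x).2⟩

lemma exists_wordAt_of_mem {n : ℕ} {w : Fin n → A} (hw : w ∈ languageOfLength X n) :
    ∃ x : X.carrier, wordAt x 0 n = w := by
  obtain ⟨x, hx, hxX⟩ := hw
  refine ⟨⟨x, hxX⟩, funext fun k => ?_⟩
  simpa [wordAt] using hx k

lemma wordAt_eq_iff {x y : X.carrier} {i j : ℤ} {n : ℕ} :
    wordAt x i n = wordAt y j n ↔ ∀ k : ℤ, 0 ≤ k → k < n → x.1 (i + k) = y.1 (j + k) := by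
  constructor
  · intro h k hk hkn
    lift k to ℕ using hk
    exact congrFun h ⟨k, by omega⟩
  · intro h
    funext k
    exact h _ (by omega) (by have := k.2; omega)

lemma wordAt_translate (x : X.carrier) (k i : ℤ) (n : ℕ) :
    wordAt (translate k x) i n = wordAt x (k + i) n := by
  rw [wordAt_eq_iff]
  intro j _ _
  simp [add_assoc]

lemma finite_language [Finite A] (n : ℕ) : (languageOfLength X n).Finite := Set.toFinite _

/-- The number of words of length `n` is nondecreasing in `n`. -/
lemma complexity_mono [Finite A] : Monotone (complexity X) := by
  intro a b hab
  have : languageOfLength X a ⊆ (fun (w : Fin b → A) (k : Fin a) => w (Fin.castLE hab k)) ''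
      languageOfLength X b := by
    intro w hw
    obtain ⟨x, rfl⟩ := exists_wordAt_of_mem hw
    exact ⟨wordAt x 0 b, wordAt_mem _ _ _, rfl⟩
  exact (Set.ncard_le_ncard this (Set.toFinite _)).trans (Set.ncard_image_le (finite_language b))

/-! ### Right special positions -/

/-- Position `i` of `x` is right special of order `n`: the word of length `n` that `x` reads there
can be followed by another letter than the one that follows it in `x`. -/
def RightSpecialAt (n : ℕ) (x : X.carrier) (i : ℤ) : Prop :=
  ∃ y : X.carrier, (∀ k, i ≤ k → k < i + n → y.1 k = x.1 k) ∧ y.1 (i + n) ≠ x.1 (i + n)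

lemma RightSpecialAt.congr {n : ℕ} {x y : X.carrier} {i j : ℤ} (h : RightSpecialAt n x i)
    (hxy : ∀ k : ℤ, 0 ≤ k → k ≤ n → x.1 (i + k) = y.1 (j + k)) : RightSpecialAt n y j := by
  obtain ⟨z, hz, hne⟩ := h
  refine ⟨translate (i - j) z, fun k hk hk' => ?_, ?_⟩
  · have h1 := hz (i - j + k) (by omega) (by omega)
    have h2 := hxy (k - j) (by omega) (by omega)
    rw [show i + (k - j) = i - j + k by ring, show j + (k - j) = k by ring] at h2
    simp [h1, h2]
  · have h2 := hxy n (by omega) le_rfl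
    rw [← h2]
    simpa [show i - j + (j + (n : ℤ)) = i + n by ring] using hne

/-- Two points that agree on `n` letters keep agreeing as long as no right special position of
order `n` is met. -/
lemma agree_of_not_rightSpecialAt {n : ℕ} {x y : X.carrier} {a b : ℤ}
    (hn : ∀ k, a ≤ k → k < a + n → y.1 k = x.1 k)
    (hrs : ∀ j, a ≤ j → j ≤ b → ¬ RightSpecialAt n x j) :
    ∀ k, a ≤ k → k ≤ b + n → y.1 k = x.1 k := by
  have key : ∀ t : ℕ, (a + t ≤ b + n) → y.1 (a + t) = x.1 (a + t) := by
    intro t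
    induction t using Nat.strong_induction_on with
    | _ t ih =>
      intro ht
      by_cases htn : t < n
      · exact hn _ (by omega) (by omega)
      · by_contra hne
        refine hrs (a + t - n) (by omega) (by omega) ⟨y, fun k hk hk' => ?_, ?_⟩
        · have := ih (k - a).toNat (by omega) (by omega)
          rwa [show a + ((k - a).toNat : ℤ) = k by omega] at this
        · simpa using hne
  intro k hk hkb
  have := key (k - a).toNat (by omega)
  rwa [show a + ((k - a).toNat : ℤ) = k by omega] at this

/-- A point that repeats a word of length `n` without meeting a right special position in between
is periodic, and without right special positions, from there on. -/
lemma periodic_right_of_repeat {n p : ℕ} {x : X.carrier} {i : ℤ} (hp : 0 < p)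
    (hw : ∀ k : ℕ, k < n → x.1 (i + k) = x.1 (i + k + p))
    (hrs : ∀ k : ℕ, k < p → ¬ RightSpecialAt n x (i + k)) :
    ∀ k : ℕ, x.1 (i + k) = x.1 (i + k + p) ∧ ¬ RightSpecialAt n x (i + k) := by
  -- The second clause lags by `n` since right speciality at `i + t - n` looks at letters up to `i +
  -- t`. It is carried over by periodicity from `p` places earlier, and in turn forces the letter
  -- `p` places after `i + t`, with `translate p x` as the competing continuation.
  have key : ∀ t : ℕ, x.1 (i + t) = x.1 (i + t + p) ∧
      (n ≤ t → ¬ RightSpecialAt n x (i + t - n)) := by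
    intro t
    induction t using Nat.strong_induction_on with
    | _ t ih =>
      have hB : n ≤ t → ¬ RightSpecialAt n x (i + t - n) := by
        intro hnt
        by_cases htp : t - n < p
        · have := hrs (t - n) htp
          rwa [Nat.cast_sub hnt, ← add_sub_assoc] at this
        · intro h
          have h2 := (ih (t - p) (by omega)).2 (by omega)
          refine h2 (h.congr fun k hk hkn => ?_)
          have h3 := (ih (t - n - p + k.toNat) (by omega)).1
          rw [show i + ((t - n - p + k.toNat : ℕ) : ℤ) = i + ((t - p : ℕ) : ℤ) - n + k by omega] at h3
          rw [h3]
          refine congrArg x.1 ?_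
          omega
      refine ⟨?_, hB⟩
      by_cases htn : t < n
      · exact hw t htn
      · by_contra hne
        refine hB (by omega) ⟨translate p x, fun k hk hk' => ?_, ?_⟩
        · have h3 := (ih (k - i).toNat (by omega)).1
          rw [show i + ((k - i).toNat : ℤ) = k by omega] at h3
          rw [h3, translate_apply, add_comm]
        · rw [translate_apply, sub_add_cancel, add_comm]
          exact fun h => hne h.symm
  intro k
  refine ⟨(key k).1, ?_⟩
  have := (key (k + n)).2 (by omega)
  rwa [show i + ((k + n : ℕ) : ℤ) - n = i + k by push_cast; ring] at this

/-- The points of `X` that are periodic and have no right special position of order `n`. -/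
def deterministicPeriodic (X : Subshift A ℤ) (n : ℕ) : Set X.carrier :=
  {x | (∃ p : ℕ, 0 < p ∧ translate p x = x) ∧ ∀ j, ¬ RightSpecialAt n x j}

/-- A point without right special positions far to the left is periodic, and has none at all. -/
lemma mem_deterministicPeriodic [Finite A] {n : ℕ} {x : X.carrier} {b : ℤ}
    (hrs : ∀ j, j ≤ b → ¬ RightSpecialAt n x j) : x ∈ deterministicPeriodic X n := by
  have hrep : ∀ c ≤ b, ∃ i < c, ∃ p : ℕ, 0 < p ∧
      ∀ k : ℕ, x.1 (i + k) = x.1 (i + k + p) ∧ ¬ RightSpecialAt n x (i + k) := by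
    intro c hc
    obtain ⟨s, t, hst, heq⟩ :=
      Finite.exists_ne_map_eq_of_infinite (fun t : ℕ => wordAt x (c - t) n)
    wlog hlt : s < t generalizing s t with H
    · exact H t s hst.symm heq.symm (by omega)
    refine ⟨c - t, by omega, t - s, by omega, periodic_right_of_repeat (by omega) ?_ ?_⟩
    · intro k hk
      have := (wordAt_eq_iff.1 heq) k (by omega) (by omega)
      rw [← this]
      refine congrArg x.1 ?_
      omega
    · intro k hk
      exact hrs _ (by omega)
  obtain ⟨i, -, p, hp, hper⟩ := hrep b le_rfl
  refine ⟨⟨p, hp, ?_⟩, fun j => ?_⟩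
  · ext t
    -- The period `p'` found further left may differ from `p`; moving `t` by a multiple of `p'` to
    -- the right of `i`, where `p` is a period, shows that `p` is a period at `t` too.
    obtain ⟨i', hi', p', hp', hper'⟩ := hrep (min b (min i t)) (by omega)
    have hmul : ∀ u ≥ i', ∀ l : ℕ, x.1 (u + l * p') = x.1 u := by
      intro u hu l
      induction l with
      | zero => simp
      | succ l ih =>
        rw [← ih]
        have h1 := (hper' (u - i' + l * p').toNat).1
        have h0 : 0 ≤ u - i' + l * p' := by
          have : (0 : ℤ) ≤ l * p' := by positivity
          omega
        rw [Int.toNat_of_nonneg h0] at h1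
        rw [show u + (l : ℤ) * p' = i' + (u - i' + l * p') by ring, h1]
        refine congrArg x.1 ?_
        push_cast
        ring
    set l := (i - t).toNat with hl
    have hlp : (i - t) ≤ l * p' := by
      have : (l : ℤ) * 1 ≤ l * p' := by gcongr; omega
      omega
    have h1 := hmul t (by omega) l
    have h2 := hmul (p + t) (by omega) l
    have h3 := (hper (t + l * p' - i).toNat).1
    rw [Int.toNat_of_nonneg (by omega)] at h3
    rw [translate_apply, ← h1, ← h2]
    rw [show i + (t + (l : ℤ) * p' - i) = t + l * p' by ring] at h3
    rw [h3]
    refine congrArg x.1 ?_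
    ring
  · obtain ⟨i', hi', p', hp', hper'⟩ := hrep (min b j) (by omega)
    have := (hper' (j - i').toNat).2
    rwa [show i' + ((j - i').toNat : ℤ) = j by omega] at this

end SlowGrowth

namespace SlowGrowth

variable {A : Type*} [TopologicalSpace A] {X : Subshift A ℤ}

/-! ### Automorphisms of bounded range -/

lemma aut_apply_translate (g : Aut X) (k : ℤ) (x : X.carrier) :
    g.1 (translate k x) = translate k (g.1 x) := by
  have h1 : ∀ y : X.carrier, g.1 (translate 1 y) = translate 1 (g.1 y) := fun y =>
    DFunLike.congr_fun (Subgroup.mem_centralizer_singleton_iff.1 g.2) y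
  induction k using Int.induction_on generalizing x with
  | zero => simp
  | succ k ih => rw [← translate_translate, h1, ih, translate_translate]
  | pred k ih =>
    have h2 : ∀ y : X.carrier, translate 1 (translate (-1) y) = y := fun y => by
      rw [translate_translate]; simp
    have h3 : ∀ y : X.carrier, translate (-1) (translate 1 y) = y := fun y => by
      rw [translate_translate]; simp
    rw [sub_eq_add_neg, ← translate_translate, ← translate_translate, ← ih]
    rw [← h3 (g.1 (translate (-1) (translate (-(k : ℤ)) x))), ← h1, h2]

/-- `f` is given by a sliding block code of range `m`. -/
def HasRange (f : X.carrier → X.carrier) (m : ℕ) : Prop :=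
  ∀ (x y : X.carrier) (t : ℤ), (∀ k, t - m ≤ k → k ≤ t + m → x.1 k = y.1 k) →
    (f x).1 t = (f y).1 t

lemma HasRange.mono {f : X.carrier → X.carrier} {m m' : ℕ} (hf : HasRange f m) (h : m ≤ m') :
    HasRange f m' :=
  fun x y t hxy => hf x y t fun k hk hk' => hxy k (by omega) (by omega)

lemma HasRange.comp {f g : X.carrier → X.carrier} {m m' : ℕ} (hf : HasRange f m)
    (hg : HasRange g m') : HasRange (f ∘ g) (m + m') :=
  fun x y t hxy => hf _ _ t fun k hk hk' => hg x y k fun l hl hl' => hxy l (by omega) (by omega)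

/-- Every automorphism is given by a sliding block code. -/
lemma exists_hasRange [Finite A] [DiscreteTopology A] (g : Aut X) : ∃ m, HasRange g.1 m := by
  have hcpt : CompactSpace X.carrier := isCompact_iff_compactSpace.1 X.isClosed.isCompact
  have hcont : Continuous fun x : X.carrier => (g.1 x).1 0 :=
    (continuous_apply 0).comp (continuous_subtype_val.comp g.1.continuous)
  -- The letter at 0 of the image is locally constant; compactness then makes the radius uniform,
  -- and commuting with translates moves it to every position.
  have hloc : ∀ x : X.carrier, ∃ m : ℕ, ∀ y : X.carrier,
      (∀ k : ℤ, -m ≤ k → k ≤ m → y.1 k = x.1 k) → (g.1 y).1 0 = (g.1 x).1 0 := by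
    intro x
    have hopen : IsOpen {y : X.carrier | (g.1 y).1 0 = (g.1 x).1 0} :=
      (isOpen_discrete {(g.1 x).1 0}).preimage hcont
    obtain ⟨U, hU, hUeq⟩ := isOpen_induced_iff.1 hopen
    have hxU : x.1 ∈ U := by
      have : x ∈ Subtype.val ⁻¹' U := by rw [hUeq]; rfl
      exact this
    obtain ⟨I, u, hu, hsub⟩ := isOpen_pi_iff.1 hU x.1 hxU
    refine ⟨I.sup Int.natAbs, fun y hy => ?_⟩
    have : y ∈ Subtype.val ⁻¹' U := by
      refine hsub fun i hi => ?_
      have hi' : i.natAbs ≤ I.sup Int.natAbs := Finset.le_sup (f := Int.natAbs) hi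
      rw [hy i (by omega) (by omega)]
      exact (hu i hi).2
    rw [hUeq] at this
    exact this
  choose m hm using hloc
  have hnhds : ∀ x : X.carrier, {y : X.carrier | ∀ k ∈ Finset.Icc (-(m x : ℤ)) (m x),
      y.1 k = x.1 k} ∈ 𝓝 x := fun x =>
    ((SymbolicDynamics.FullShift.isOpen_cylinder (Finset.Icc (-(m x : ℤ)) (m x)) x.1).preimage
      continuous_subtype_val).mem_nhds fun _ _ => rfl
  obtain ⟨T, -, hT⟩ := isCompact_univ.elim_nhds_subcover _ fun x _ => hnhds x
  refine ⟨T.sup m, fun x y t hxy => ?_⟩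
  obtain ⟨z, hz⟩ := Set.mem_iUnion.1 (hT (Set.mem_univ (translate t x)))
  obtain ⟨hzT, hz⟩ := Set.mem_iUnion.1 hz
  have hmz : m z ≤ T.sup m := Finset.le_sup hzT
  have h1 := hm z (translate t x) fun k hk hk' => hz k (Finset.mem_Icc.2 ⟨hk, hk'⟩)
  have h2 := hm z (translate t y) fun k hk hk' => by
    rw [← hz k (Finset.mem_Icc.2 ⟨hk, hk'⟩), translate_apply, translate_apply,
      hxy _ (by omega) (by omega)]
  rw [aut_apply_translate] at h1 h2
  simpa using h1.trans h2.symm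

/-- The automorphisms of range `m` whose inverse has range `m`. -/
def autOfRange (X : Subshift A ℤ) (m : ℕ) : Set (Aut X) :=
  {g | HasRange g.1 m ∧ HasRange (g⁻¹).1 m}

lemma one_mem_autOfRange (m : ℕ) : (1 : Aut X) ∈ autOfRange X m := by
  have : HasRange (id : X.carrier → X.carrier) m :=
    fun x y t hxy => hxy t (by omega) (by omega)
  exact ⟨this, by rw [inv_one]; exact this⟩

lemma autOfRange_mono : Monotone (autOfRange X) :=
  fun _ _ h _ hg => ⟨hg.1.mono h, hg.2.mono h⟩

lemma mul_mem_autOfRange {g h : Aut X} {a b : ℕ} (hg : g ∈ autOfRange X a)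
    (hh : h ∈ autOfRange X b) : g * h ∈ autOfRange X (b + a) := by
  refine ⟨?_, ?_⟩
  · rw [add_comm]
    exact hg.1.comp hh.1
  · rw [mul_inv_rev]
    exact hh.2.comp hg.2

lemma exists_mem_autOfRange [Finite A] [DiscreteTopology A] (g : Aut X) :
    ∃ m, g ∈ autOfRange X m := by
  obtain ⟨a, ha⟩ := exists_hasRange g
  obtain ⟨b, hb⟩ := exists_hasRange g⁻¹
  exact ⟨max a b, ha.mono (le_max_left _ _), hb.mono (le_max_right _ _)⟩

/-! ### Automorphisms that agree on a long window -/

/-- If the images of `x` under two automorphisms of range `m` agree on a long window, they agree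
to the right of it as long as `x` has no right special position. -/
lemma agree_of_agree_window {m n : ℕ} {φ ψ : Aut X} (hφ : φ ∈ autOfRange X m)
    {x : X.carrier} {a b : ℤ}
    (hagree : ∀ k, a ≤ k → k < a + n + 2 * m → (φ.1 x).1 k = (ψ.1 x).1 k)
    (hrs : ∀ j, a + m ≤ j → j ≤ b → ¬ RightSpecialAt n x j) :
    ∀ t, a ≤ t → t ≤ b + n - m → (φ.1 x).1 t = (ψ.1 x).1 t := by
  have key : ∀ s : ℕ, a + s ≤ b + n - m → (φ.1 x).1 (a + s) = (ψ.1 x).1 (a + s) := by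
    intro s
    induction s using Nat.strong_induction_on with
    | _ s ih =>
      intro hs
      by_cases hsw : (s : ℤ) < n + 2 * m
      · exact hagree _ (by omega) (by omega)
      -- The range of `φ⁻¹` turns agreement of the images into agreement of `z` with `x` on `n`
      -- letters; determinism extends it to the right, and `φ` carries it back to the images.
      set z : X.carrier := (φ⁻¹).1 (ψ.1 x) with hz
      have hφz : φ.1 z = ψ.1 x := by simp [hz]
      have hxz : (φ⁻¹).1 (φ.1 x) = x := by simp
      have hzx : ∀ k, a + m ≤ k → k < a + m + n → z.1 k = x.1 k := by
        intro k hk hk'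
        rw [← hxz]
        refine (hφ.2 _ _ k fun l hl hl' => ?_).symm
        have := ih (l - a).toNat (by omega) (by omega)
        rwa [show a + ((l - a).toNat : ℤ) = l by omega] at this
      have := agree_of_not_rightSpecialAt hzx hrs
      rw [← hφz]
      exact hφ.1 _ _ _ fun k hk hk' => (this k (by omega) (by omega)).symm
  intro t ht htb
  have := key (t - a).toNat (by omega)
  rwa [show a + ((t - a).toNat : ℤ) = t by omega] at this

/-! ### A small set of test points -/

/-- The words of length `n + 1` whose prefix of length `n` is right special. -/
def rightSpecialEdges (X : Subshift A ℤ) (n : ℕ) : Set (Fin (n + 1) → A) :=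
  {e | ∃ x : X.carrier, wordAt x 0 (n + 1) = e ∧ RightSpecialAt n x 0}

/-- `S` is a set of test points of order `n`: it meets every cylinder of a word in
`rightSpecialEdges X n` and every shift orbit of `deterministicPeriodic X n`. -/
structure IsTestSet (n : ℕ) (S : Set X.carrier) : Prop where
  edges : ∀ e ∈ rightSpecialEdges X n, ∃ s ∈ S, wordAt s 0 (n + 1) = e
  periodic : ∀ x ∈ deterministicPeriodic X n, ∃ s ∈ S, ∃ k : ℤ, translate k x = s

lemma translate_mul_of_period {x : X.carrier} {p : ℕ} (hp : translate p x = x) (l : ℤ) :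
    translate (l * p) x = x := by
  induction l using Int.induction_on with
  | zero => simp
  | succ l ih => rw [add_mul, one_mul, ← translate_translate, ih, hp]
  | pred l ih =>
    rw [sub_mul, one_mul, sub_eq_add_neg, ← translate_translate, ih]
    nth_rw 1 [← hp]
    rw [translate_translate]
    simp

/-- Automorphisms of range `m` are determined by a window of the images of the test points. -/
lemma eq_of_agree_on_testSet [Finite A] {m n : ℕ} (hm : 0 < m) (hmn : 2 * m ≤ n) {S : Set X.carrier}
    (hS : IsTestSet n S) {φ ψ : Aut X} (hφ : φ ∈ autOfRange X m) (hψ : ψ ∈ autOfRange X m)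
    (hagree : ∀ s ∈ S, wordAt (φ.1 s) 0 (n + 4 * m) = wordAt (ψ.1 s) 0 (n + 4 * m)) : φ = ψ := by
  have hagree' : ∀ s ∈ S, ∀ k : ℤ, 0 ≤ k → k < n + 4 * m → (φ.1 s).1 k = (ψ.1 s).1 k := by
    intro s hs k hk hk'
    have := wordAt_eq_iff.1 (hagree s hs) k hk (by push_cast; omega)
    simpa using this
  suffices H : ∀ x : X.carrier, (φ.1 x).1 0 = (ψ.1 x).1 0 by
    ext x t
    have := H (translate t x)
    rw [aut_apply_translate, aut_apply_translate] at this
    simpa using this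
  intro x
  by_cases hrs : ∃ i : ℤ, i ≤ -m ∧ RightSpecialAt n x i
  -- Take the last right special position up to `-m`: from there the edge forces `x` up to `n - m`,
  -- hence the images up to `n - 2m ≥ 0`.
  · obtain ⟨i, ⟨him, hi⟩, hmax⟩ := Int.exists_greatest_of_bdd
      (P := fun i => i ≤ -m ∧ RightSpecialAt n x i) ⟨-m, fun _ h => h.1⟩ hrs
    have hno : ∀ j, i + 1 ≤ j → j ≤ -m → ¬ RightSpecialAt n x j := fun j hj hj' h => by
      have := hmax j ⟨hj', h⟩
      omega
    obtain ⟨s, hsS, hs⟩ := hS.edges (wordAt x i (n + 1))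
      ⟨translate i x, by simp [wordAt_translate],
        hi.congr fun k _ _ => by simp⟩
    set y := translate (-i) s with hy
    have hyx : ∀ k, i + 1 ≤ k → k < i + 1 + n → y.1 k = x.1 k := by
      intro k hk hk'
      have := wordAt_eq_iff.1 hs (k - i) (by omega) (by push_cast; omega)
      simpa [hy, show -i + k = k - i by ring] using this
    have hyx0 : y.1 i = x.1 i := by
      have := wordAt_eq_iff.1 hs 0 le_rfl (by push_cast; omega)
      simpa [hy] using this
    have hext := agree_of_not_rightSpecialAt hyx hno
    have hext' : ∀ k, i ≤ k → k ≤ -m + n → x.1 k = y.1 k := by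
      intro k hk hk'
      rcases hk.eq_or_lt with rfl | hk
      · exact hyx0.symm
      · exact (hext k (by omega) hk').symm
    have himg : ∀ k, i + m ≤ k → k < i + n + 4 * m → k ≤ n - 2 * m →
        (φ.1 x).1 k = (ψ.1 x).1 k := by
      intro k hk hk' hk''
      rw [hφ.1 x y k fun l hl hl' => hext' l (by omega) (by omega),
        hψ.1 x y k fun l hl hl' => hext' l (by omega) (by omega), hy,
        aut_apply_translate, aut_apply_translate]
      exact hagree' s hsS _ (by omega) (by omega)
    -- Either the test window already covers 0, or it lies to the left and agreement propagates to
    -- 0.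
    by_cases h0 : 0 < i + n + 4 * m
    · exact himg 0 (by omega) h0 (by omega)
    · refine agree_of_agree_window (m := m) (n := n) hφ (a := i + m) (b := -m)
        (fun k hk hk' => himg k (by omega) (by omega) (by omega))
        (fun j hj hj' => hno j (by omega) hj') 0 ?_ ?_ <;> omega
  · push Not at hrs
    have hx := mem_deterministicPeriodic hrs
    obtain ⟨s, hsS, c, hc⟩ := hS.periodic x hx
    obtain ⟨⟨p, hp, hper⟩, hno⟩ := hx
    -- Congruent to `c` modulo the period, but nonpositive, since agreement propagates only to the
    -- right.
    set i : ℤ := -(|c| * p) + c with hi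
    have hi0 : i ≤ 0 := by
      have h1 : |c| * 1 ≤ |c| * p := by gcongr; omega
      have := le_abs_self c
      omega
    have his : translate i x = s := by
      rw [hi, ← neg_mul, ← translate_translate, translate_mul_of_period hper, hc]
    have himg : ∀ k, i ≤ k → k < i + n + 2 * m → (φ.1 x).1 k = (ψ.1 x).1 k := by
      intro k hk hk'
      have := hagree' s hsS (k - i) (by omega) (by omega)
      rw [← his, aut_apply_translate, aut_apply_translate] at this
      simpa using this
    exact agree_of_agree_window (b := m) hφ himg (fun j _ _ => hno j) 0 hi0 (by omega)

/-- The number of automorphisms of range `m` is bounded through the size of a test set. -/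
lemma ncard_autOfRange_le [Finite A] {m n : ℕ} (hm : 0 < m) (hmn : 2 * m ≤ n) {S : Set X.carrier}
    (hSfin : S.Finite) (hS : IsTestSet n S) :
    (autOfRange X m).Finite ∧
      (autOfRange X m).ncard ≤ complexity X (n + 4 * m) ^ S.ncard := by
  have := hSfin.to_subtype
  have := (finite_language (X := X) (n + 4 * m)).to_subtype
  let F : autOfRange X m → S → languageOfLength X (n + 4 * m) :=
    fun φ s => ⟨wordAt (φ.1.1 s.1) 0 (n + 4 * m), wordAt_mem _ _ _⟩
  have hF : Function.Injective F := by
    intro φ ψ h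
    refine Subtype.ext (eq_of_agree_on_testSet hm hmn hS φ.2 ψ.2 fun s hs => ?_)
    exact congrArg Subtype.val (congrFun h ⟨s, hs⟩)
  refine ⟨Finite.of_injective F hF, ?_⟩
  have := Nat.card_le_card_of_injective F hF
  rwa [Nat.card_fun, Nat.card_coe_set_eq, Nat.card_coe_set_eq, Nat.card_coe_set_eq] at this

end SlowGrowth

namespace SlowGrowth

/-- If `f` maps `W` onto `V`, at most `2 (|W| - |V|)` points of `W` share their value with
another point of `W`. -/
lemma ncard_nonunique_add_le {α β : Type*} {W : Set α} (hW : W.Finite) (f : α → β) :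
    {w ∈ W | ∃ w' ∈ W, w' ≠ w ∧ f w' = f w}.ncard + 2 * (f '' W).ncard ≤ 2 * W.ncard := by
  -- `V` picks one point from each fibre. A point sharing its value is outside `V`, or represents a
  -- fibre that also meets `W \ V`; each kind numbers at most `|W \ V|`.
  obtain ⟨V, hVW, hV⟩ := (Set.surjOn_image f W).exists_bijOn_subset
  have hVfin : V.Finite := hW.subset hVW
  have hDfin : (W \ V).Finite := hW.subset Set.sdiff_subset
  have hVcard : V.ncard = (f '' W).ncard := by
    rw [← hV.image_eq, hV.injOn.ncard_image]
  have hD : (W \ V).ncard + V.ncard = W.ncard := Set.ncard_sdiff_add_ncard_of_subset hVW hW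
  have hR : {v ∈ V | f v ∈ f '' (W \ V)}.ncard ≤ (W \ V).ncard := by
    refine le_trans ?_ (Set.ncard_image_le (f := f) hDfin)
    exact Set.ncard_le_ncard_of_injOn f (fun v hv => hv.2)
      (hV.injOn.mono (Set.sep_subset _ _)) (hDfin.image f)
  have hsub : {w ∈ W | ∃ w' ∈ W, w' ≠ w ∧ f w' = f w} ⊆
      (W \ V) ∪ {v ∈ V | f v ∈ f '' (W \ V)} := by
    rintro w ⟨hw, w', hw', hne, hf⟩
    by_cases hwV : w ∈ V
    · refine Or.inr ⟨hwV, w', ⟨hw', fun h => hne (hV.injOn h hwV hf)⟩, hf⟩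
    · exact Or.inl ⟨hw, hwV⟩
  have h1 := Set.ncard_le_ncard hsub (hDfin.union (hVfin.subset (Set.sep_subset _ _)))
  have h2 := Set.ncard_union_le (W \ V) {v ∈ V | f v ∈ f '' (W \ V)}
  omega

variable {A : Type*} [TopologicalSpace A] {X : Subshift A ℤ}

/-! ### Counting test points -/

/-- Such an edge shares its prefix with another word of the language, so `ncard_nonunique_add_le`
applies to deletion of the last letter. -/
lemma ncard_rightSpecialEdges_add_le [Finite A] (n : ℕ) :
    (rightSpecialEdges X n).ncard + 2 * complexity X n ≤ 2 * complexity X (n + 1) := by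
  have hinit : ∀ x : X.carrier, Fin.init (wordAt x 0 (n + 1)) = wordAt x 0 n := fun x => by
    funext k
    simp [Fin.init, wordAt]
  have himage : (fun w : Fin (n + 1) → A => (Fin.init w : Fin n → A)) ''
      languageOfLength X (n + 1) = languageOfLength X n := by
    ext w
    constructor
    · rintro ⟨v, hv, rfl⟩
      obtain ⟨x, rfl⟩ := exists_wordAt_of_mem hv
      dsimp only
      rw [hinit]
      exact wordAt_mem _ _ _
    · intro hw
      obtain ⟨x, rfl⟩ := exists_wordAt_of_mem hw
      exact ⟨wordAt x 0 (n + 1), wordAt_mem _ _ _, hinit x⟩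
  have h := ncard_nonunique_add_le (finite_language (X := X) (n + 1))
    (fun w : Fin (n + 1) → A => (Fin.init w : Fin n → A))
  rw [himage] at h
  refine le_trans (Nat.add_le_add_right (Set.ncard_le_ncard ?_ (Set.toFinite _)) _) h
  rintro e ⟨x, rfl, y, hy, hne⟩
  refine ⟨wordAt_mem _ _ _, wordAt y 0 (n + 1), wordAt_mem _ _ _, fun h => hne ?_, ?_⟩
  · exact wordAt_eq_iff.1 h n (by omega) (by push_cast; omega)
  · rw [hinit, hinit, wordAt_eq_iff]
    exact fun k hk hk' => hy _ (by omega) (by omega)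

lemma iterate_translate_one (x : X.carrier) (k : ℕ) :
    (translate (1 : ℤ))^[k] x = translate k x := by
  induction k with
  | zero => simp
  | succ k ih =>
    rw [Function.iterate_succ_apply', ih, translate_translate]
    push_cast
    rfl

lemma isPeriodicPt_translate_iff {x : X.carrier} {p : ℕ} :
    Function.IsPeriodicPt (translate (1 : ℤ)) p x ↔ translate p x = x := by
  rw [Function.IsPeriodicPt, Function.IsFixedPt, iterate_translate_one]

/-- Periodic points that agree on all nonnegative coordinates are equal. -/
lemma eq_of_periodic_of_agree_nonneg {x y : X.carrier} {p q : ℕ} (hp : 0 < p) (hq : 0 < q)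
    (hx : translate p x = x) (hy : translate q y = y)
    (h : ∀ k : ℤ, 0 ≤ k → x.1 k = y.1 k) : x = y := by
  have hx' := translate_mul_of_period hx
  have hy' := translate_mul_of_period hy
  ext t
  rw [← hx' (|t| * q), ← hy' (|t| * p), translate_apply, translate_apply,
    show |t| * (p : ℤ) * q = |t| * q * p by ring]
  refine h _ ?_
  have hpq : (1 : ℤ) ≤ q * p := by
    have := Nat.mul_pos hq hp
    exact_mod_cast this
  have : |t| * 1 ≤ |t| * (q * p) := by gcongr
  have := neg_abs_le t
  rw [mul_assoc]
  omega

/-- A periodic point of period `p` and one of period `q` that agree on `p + q` consecutive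
coordinates are equal. -/
lemma eq_of_periodic_of_agree_window {x y : X.carrier} {p q : ℕ} (hp : 0 < p) (hq : 0 < q)
    (hx : translate p x = x) (hy : translate q y = y)
    (h : ∀ k : ℤ, 0 ≤ k → k < p + q → x.1 k = y.1 k) : x = y := by
  have hx' : ∀ t : ℤ, x.1 (p + t) = x.1 t := fun t => by rw [← translate_apply, hx]
  have hy' : ∀ t : ℤ, y.1 (q + t) = y.1 t := fun t => by rw [← translate_apply, hy]
  have key : ∀ t : ℕ, x.1 t = y.1 t := by
    intro t
    induction t using Nat.strong_induction_on with
    | _ t ih =>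
      by_cases ht : t < p + q
      · exact h t (by omega) (by omega)
      obtain ⟨s, rfl⟩ : ∃ s, t = p + (q + s) := ⟨t - p - q, by omega⟩
      -- Go down by `p` in `x`, by `q` in `y`, then back up by `p` in `x` and by `q` in `y`,
      -- switching between the points by induction.
      have e1 := ih (q + s) (by omega)
      have e2 := ih s (by omega)
      have e3 := ih (p + s) (by omega)
      push_cast at e1 e2 e3 ⊢
      rw [hx', e1, hy', ← e2, ← hx', e3, show (p : ℤ) + (q + s) = q + (p + s) by ring, hy']
  refine eq_of_periodic_of_agree_nonneg hp hq hx hy fun k hk => ?_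
  lift k to ℕ using hk
  exact key k

/-- If points of different orbits, with at least `q` points in each orbit, are separated by
words of length `l`, there are at most `P(l) / q` of them. -/
lemma ncard_mul_le_complexity [Finite A] {U : Set X.carrier} {q l : ℕ}
    (hq : ∀ y ∈ U, q ≤ Function.minimalPeriod (translate (1 : ℤ)) y)
    (horb : ∀ y ∈ U, ∀ z ∈ U, ∀ k : ℤ, translate k y = z → y = z)
    (hsep : ∀ y ∈ U, ∀ z ∈ U, ∀ i j : ℤ, wordAt y i l = wordAt z j l →
      translate i y = translate j z) :
    U.ncard * q ≤ complexity X l := by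
  have := (finite_language (X := X) l).to_subtype
  let F : U × Fin q → languageOfLength X l :=
    fun v => ⟨wordAt v.1.1 (v.2 : ℕ) l, wordAt_mem _ _ _⟩
  have hF : Function.Injective F := by
    rintro ⟨⟨y, hy⟩, i⟩ ⟨⟨z, hz⟩, j⟩ h
    have h1 := hsep y hy z hz i j (congrArg Subtype.val h)
    have h2 : translate ((i : ℤ) - j) y = z := by
      rw [sub_eq_add_neg, ← translate_translate, h1, translate_translate]
      simp
    obtain rfl := horb y hy z hz _ h2
    have hij : ∀ a b : ℕ, b ≤ a → a < q → translate ((a : ℤ) - b) y = y → a = b := by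
      intro a b hba ha hab
      rw [← Nat.cast_sub hba, ← isPeriodicPt_translate_iff] at hab
      have := hab.eq_zero_of_lt_minimalPeriod (by have := hq y hy; omega)
      omega
    have : (i : ℕ) = j := by
      rcases le_total (j : ℕ) i with hji | hji
      · exact hij i j hji i.2 h2
      · refine (hij j i hji j.2 ?_).symm
        nth_rw 1 [← h2]
        rw [translate_translate]
        simp
    simp [Fin.ext this]
  have h := Nat.card_le_card_of_injective F hF
  rwa [Nat.card_prod, Nat.card_fin, Nat.card_coe_set_eq, Nat.card_coe_set_eq] at h

/-- Without right special positions `n` letters force the whole future, and periodicity then forces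
the past. -/
lemma eq_of_mem_deterministicPeriodic_of_wordAt_eq {n : ℕ} {y z : X.carrier}
    (hy : y ∈ deterministicPeriodic X n) (hz : z ∈ deterministicPeriodic X n)
    (h : wordAt y 0 n = wordAt z 0 n) : y = z := by
  obtain ⟨⟨p, hp, hpy⟩, -⟩ := hy
  obtain ⟨⟨q, hq, hqz⟩, hrs⟩ := hz
  refine eq_of_periodic_of_agree_nonneg hp hq hpy hqz fun k hk => ?_
  refine agree_of_not_rightSpecialAt (a := 0) (b := k) (fun i hi hi' => ?_)
    (fun j _ _ => hrs j) k hk (by omega)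
  simpa using wordAt_eq_iff.1 h i hi (by omega)

lemma translate_mem_deterministicPeriodic {n : ℕ} {y : X.carrier}
    (hy : y ∈ deterministicPeriodic X n) (k : ℤ) :
    translate k y ∈ deterministicPeriodic X n := by
  obtain ⟨⟨p, hp, hpy⟩, hrs⟩ := hy
  refine ⟨⟨p, hp, ?_⟩, fun j hj => hrs (k + j) (hj.congr fun i _ _ => ?_)⟩
  · rw [translate_translate, add_comm, ← translate_translate, hpy]
  · simp [add_assoc]

/-- The deterministic periodic points have a finite set of representatives of their orbits. -/
lemma exists_orbit_representatives [Finite A] (X : Subshift A ℤ) (n : ℕ) :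
    ∃ T ⊆ deterministicPeriodic X n, T.Finite ∧
      (∀ x ∈ deterministicPeriodic X n, ∃ s ∈ T, ∃ k : ℤ, translate k x = s) ∧
      ∀ y ∈ T, ∀ z ∈ T, ∀ k : ℤ, translate k y = z → y = z := by
  let r : Setoid X.carrier :=
    { r := fun x y => ∃ k : ℤ, translate k x = y
      iseqv := ⟨fun x => ⟨0, by simp⟩, fun {x y} ⟨k, hk⟩ => ⟨-k, by
        rw [← hk, translate_translate]; simp⟩, fun {x y z} ⟨k, hk⟩ ⟨l, hl⟩ => ⟨k + l, by
        rw [← translate_translate, hk, hl]⟩⟩ }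
  have hout : ∀ x : X.carrier, ∃ k : ℤ, translate k x = (Quotient.mk r x).out := fun x =>
    r.symm (Quotient.mk_out x)
  have hfin : (deterministicPeriodic X n).Finite :=
    Set.Finite.of_injOn (f := fun x => wordAt x 0 n) (t := Set.univ) (fun _ _ => trivial)
      (fun x hx y hy h => eq_of_mem_deterministicPeriodic_of_wordAt_eq hx hy h) Set.finite_univ
  have hsub : (fun x => (Quotient.mk r x).out) '' deterministicPeriodic X n ⊆
      deterministicPeriodic X n := by
    rintro _ ⟨x, hx, rfl⟩
    obtain ⟨k, hk⟩ := hout x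
    dsimp only
    rw [← hk]
    exact translate_mem_deterministicPeriodic hx k
  refine ⟨_, hsub, hfin.subset hsub, fun x hx => ⟨_, ⟨x, hx, rfl⟩, hout x⟩, ?_⟩
  rintro _ ⟨x, hx, rfl⟩ _ ⟨y, hy, rfl⟩ k hk
  have h1 : Quotient.mk r (Quotient.mk r x).out = Quotient.mk r (Quotient.mk r y).out :=
    Quotient.sound ⟨k, hk⟩
  rw [Quotient.out_eq, Quotient.out_eq] at h1
  exact congrArg Quotient.out h1

/-- A set of representatives of orbits of deterministic periodic points is small: group them by
the dyadic size of their minimal period. -/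
lemma ncard_representatives_le [Finite A] {n : ℕ} {T : Set X.carrier}
    (hT : T ⊆ deterministicPeriodic X n) (hfin : T.Finite)
    (horb : ∀ y ∈ T, ∀ z ∈ T, ∀ k : ℤ, translate k y = z → y = z) {B : ℕ}
    (hB : ∀ j c : ℕ, c * 2 ^ j ≤ complexity X n → c * 2 ^ j ≤ complexity X (2 ^ (j + 2)) →
      c ≤ B) :
    T.ncard ≤ (Nat.log 2 (complexity X n) + 1) * B := by
  classical
  set per : X.carrier → ℕ := Function.minimalPeriod (translate (1 : ℤ)) with hper
  have hpos : ∀ y ∈ T, 0 < per y := fun y hy => by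
    obtain ⟨⟨p, hp, hpy⟩, -⟩ := hT hy
    exact (isPeriodicPt_translate_iff.2 hpy).minimalPeriod_pos hp
  have hperiod : ∀ y : X.carrier, translate (per y) y = y := fun y =>
    isPeriodicPt_translate_iff.1 (Function.isPeriodicPt_minimalPeriod _ y)
  have hsep : ∀ y ∈ T, ∀ z ∈ T, ∀ i j : ℤ, wordAt y i n = wordAt z j n →
      translate i y = translate j z := fun y hy z hz i j h =>
    eq_of_mem_deterministicPeriodic_of_wordAt_eq (translate_mem_deterministicPeriodic (hT hy) i)
      (translate_mem_deterministicPeriodic (hT hz) j) (by simpa [wordAt_translate] using h)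
  -- A single orbit already shows as many words as its period; this bounds the number of dyadic
  -- classes.
  have hle : ∀ y ∈ T, per y ≤ complexity X n := fun y hy => by
    have := ncard_mul_le_complexity (U := {y}) (q := per y) (l := n)
      (by rintro z rfl; exact le_rfl) (by rintro z rfl w rfl _ _; rfl)
      (by rintro z rfl w rfl; exact hsep _ hy _ hy)
    simpa using this
  have hfiber : ∀ j, {y ∈ T | Nat.log 2 (per y) = j}.ncard ≤ B := by
    intro j
    have hlow : ∀ y ∈ {y ∈ T | Nat.log 2 (per y) = j}, 2 ^ j ≤ per y := by
      rintro y ⟨hy, rfl⟩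
      exact Nat.pow_log_le_self 2 (hpos y hy).ne'
    have hup : ∀ y ∈ {y ∈ T | Nat.log 2 (per y) = j}, per y < 2 ^ (j + 1) := by
      rintro y ⟨hy, rfl⟩
      exact Nat.lt_pow_succ_log_self (by norm_num) _
    refine hB j _ (ncard_mul_le_complexity hlow (fun y hy z hz => horb y hy.1 z hz.1)
      fun y hy z hz => hsep y hy.1 z hz.1)
      (ncard_mul_le_complexity hlow (fun y hy z hz => horb y hy.1 z hz.1) ?_)
    intro y hy z hz i k h
    have hcomm : ∀ (w : X.carrier) (l : ℤ), translate (per w) (translate l w) = translate l w :=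
      fun w l => by rw [translate_translate, add_comm, ← translate_translate, hperiod]
    refine eq_of_periodic_of_agree_window (hpos y hy.1) (hpos z hz.1) (hcomm y i) (hcomm z k) ?_
    intro t ht ht'
    have h1 := hup y hy
    have h2 := hup z hz
    refine wordAt_eq_iff.1 h t ht ?_
    have : per y + per z < 2 ^ (j + 2) := by rw [pow_succ] at h1 h2 ⊢; rw [pow_succ]; omega
    have : ((per y + per z : ℕ) : ℤ) < (2 ^ (j + 2) : ℕ) := by exact_mod_cast this
    push_cast at this ⊢
    omega
  rw [Set.ncard_eq_toFinset_card T hfin]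
  have hmaps : ∀ y ∈ hfin.toFinset, Nat.log 2 (per y) ∈
      Finset.range (Nat.log 2 (complexity X n) + 1) := fun y hy => by
    rw [Finset.mem_range, Nat.lt_succ_iff]
    exact Nat.log_mono_right (hle y (hfin.mem_toFinset.1 hy))
  have := Finset.card_le_mul_card_image_of_maps_to hmaps B fun j _ => by
    rw [← Set.ncard_coe_finset]
    refine le_trans (le_of_eq ?_) (hfiber j)
    congr 1
    ext y
    simp
  rwa [Finset.card_range, mul_comm] at this

/-- There is a finite test set whose size is controlled by the complexity. -/
lemma exists_isTestSet [Finite A] (X : Subshift A ℤ) (n : ℕ) :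
    ∃ S : Set X.carrier, S.Finite ∧ IsTestSet n S ∧
      ∀ B : ℕ, (∀ j c : ℕ, c * 2 ^ j ≤ complexity X n →
        c * 2 ^ j ≤ complexity X (2 ^ (j + 2)) → c ≤ B) →
      S.ncard ≤ 2 * (complexity X (n + 1) - complexity X n) +
        (Nat.log 2 (complexity X n) + 1) * B := by
  obtain ⟨T, hT, hfin, hrep, horb⟩ := exists_orbit_representatives X n
  choose s hs using fun e (he : e ∈ rightSpecialEdges X n) =>
    (show ∃ x : X.carrier, wordAt x 0 (n + 1) = e from he.imp fun _ h => h.1)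
  have hR : (Set.range fun e : rightSpecialEdges X n => s e.1 e.2).ncard ≤
      (rightSpecialEdges X n).ncard := by
    rw [← Set.image_univ, ← Nat.card_coe_set_eq (rightSpecialEdges X n), ← Set.ncard_univ]
    exact Set.ncard_image_le Set.finite_univ
  refine ⟨(Set.range fun e : rightSpecialEdges X n => s e.1 e.2) ∪ T,
    (Set.finite_range _).union hfin,
    ⟨fun e he => ⟨s e he, Or.inl ⟨⟨e, he⟩, rfl⟩, hs e he⟩, fun x hx => ?_⟩, fun B hB => ?_⟩
  · obtain ⟨t, ht, h⟩ := hrep x hx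
    exact ⟨t, Or.inr ht, h⟩
  · have h1 := Set.ncard_union_le (Set.range fun e : rightSpecialEdges X n => s e.1 e.2) T
    have h3 := ncard_rightSpecialEdges_add_le (X := X) n
    have h4 := ncard_representatives_le hT hfin horb hB
    omega

end SlowGrowth

namespace SlowGrowth

/-! ### Estimates -/

section Estimates

variable {P : ℕ → ℕ}

lemma eventually_mul_log_sq_le
    (hP : (fun n : ℕ => (P n : ℝ)) =o[atTop] fun n : ℕ => (n : ℝ) ^ 2 / (Real.log n) ^ 2)
    {ε : ℝ} (hε : 0 < ε) : ∀ᶠ n : ℕ in atTop, (P n : ℝ) * Real.log n ^ 2 ≤ ε * (n : ℝ) ^ 2 := by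
  filter_upwards [hP.def hε, eventually_gt_atTop 1] with n hn hn1
  have hlog : 0 < Real.log n := Real.log_pos (by exact_mod_cast hn1)
  rw [Real.norm_of_nonneg (by positivity), Real.norm_of_nonneg (by positivity)] at hn
  rwa [← mul_div_assoc, le_div_iff₀ (by positivity)] at hn

/-- A bound of `P (12 * q)` that is uniform in `q ≤ m`. -/
lemma eventually_forall_mul_log_sq_le (hmono : Monotone P)
    (hP : (fun n : ℕ => (P n : ℝ)) =o[atTop] fun n : ℕ => (n : ℝ) ^ 2 / (Real.log n) ^ 2)
    {ε : ℝ} (hε : 0 < ε) : ∀ᶠ m : ℕ in atTop, ∀ q : ℕ, 1 ≤ q → q ≤ m →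
      (P (12 * q) : ℝ) * Real.log m ^ 2 ≤ ε * (q * m) := by
  obtain ⟨N, hN⟩ := eventually_atTop.1
    (eventually_mul_log_sq_le hP (ε := ε / 576) (by positivity))
  obtain ⟨K, hK0, hK⟩ : ∃ K : ℝ, 0 < K ∧ ∀ q : ℕ, 1 ≤ q → (P (12 * q) : ℝ) ≤ K * q ^ 2 := by
    obtain ⟨N', hN'⟩ := eventually_atTop.1 (eventually_mul_log_sq_le hP one_pos)
    set N₁ := max N' 3
    refine ⟨P (12 * N₁) + 144, by positivity, fun q hq => ?_⟩
    have hq' : (1 : ℝ) ≤ (q : ℝ) ^ 2 := one_le_pow₀ (by exact_mod_cast hq)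
    rcases le_total q N₁ with h | h
    · have h1 : (P (12 * q) : ℝ) ≤ P (12 * N₁) := by exact_mod_cast hmono (by omega)
      nlinarith [Nat.cast_nonneg (α := ℝ) (P (12 * N₁))]
    · have h1 := hN' (12 * q) (by omega)
      have hlog : 1 ≤ Real.log ((12 * q : ℕ) : ℝ) := by
        rw [Real.le_log_iff_exp_le (by positivity)]
        refine Real.exp_one_lt_three.le.trans ?_
        exact_mod_cast (by omega : 3 ≤ 12 * q)
      have h2 : (P (12 * q) : ℝ) * 1 ≤ P (12 * q) * Real.log ((12 * q : ℕ) : ℝ) ^ 2 := by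
        gcongr
        exact one_le_pow₀ hlog
      push_cast at h1 h2
      nlinarith [Nat.cast_nonneg (α := ℝ) (P (12 * N₁))]
  have hsqrt : Tendsto (fun m : ℕ => √(m : ℝ)) atTop atTop :=
    Real.tendsto_sqrt_atTop.comp tendsto_natCast_atTop_atTop
  have hlogsqrt := hsqrt.eventually ((Real.isLittleO_pow_log_id_atTop (n := 2)).def
    (c := ε / (4 * K)) (by positivity))
  filter_upwards [hlogsqrt, eventually_ge_atTop (N ^ 2), eventually_gt_atTop 1]
    with m hm hmN hm1 q hq hqm
  have hm0 : (0 : ℝ) < m := by positivity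
  have hq0 : (0 : ℝ) < q := by positivity
  have hlogm : 0 < Real.log m := Real.log_pos (by exact_mod_cast hm1)
  -- For `q ≥ √m` the logarithms of `m` and `12 q` are comparable, and `576 = 4 * 12²`. For `q ≤ √m`
  -- the crude bound `K q² ≤ K q √m` suffices, because `log² m = o(√m)`.
  rcases le_total m (q ^ 2) with h | h
  · have hNq : N ≤ q := by
      by_contra hlt
      push Not at hlt
      exact absurd (hmN.trans h) (not_le.2 (Nat.pow_lt_pow_left hlt (by norm_num)))
    have h1 := hN (12 * q) (by omega)
    have hlog : Real.log m ≤ 2 * Real.log ((12 * q : ℕ) : ℝ) := by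
      have h2 : Real.log m ≤ Real.log ((q : ℝ) ^ 2) :=
        Real.log_le_log hm0 (by exact_mod_cast h)
      rw [Real.log_pow] at h2
      have h3 : Real.log q ≤ Real.log ((12 * q : ℕ) : ℝ) :=
        Real.log_le_log hq0 (by exact_mod_cast (by omega : q ≤ 12 * q))
      push_cast at h2 h3 ⊢
      linarith
    have h4 : Real.log m ^ 2 ≤ (2 * Real.log ((12 * q : ℕ) : ℝ)) ^ 2 := by gcongr
    have h5 : (q : ℝ) * q ≤ q * m := by gcongr
    calc (P (12 * q) : ℝ) * Real.log m ^ 2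
        ≤ P (12 * q) * (2 * Real.log ((12 * q : ℕ) : ℝ)) ^ 2 := by gcongr
      _ = 4 * (P (12 * q) * Real.log ((12 * q : ℕ) : ℝ) ^ 2) := by ring
      _ ≤ 4 * (ε / 576 * ((12 * q : ℕ) : ℝ) ^ 2) := by gcongr
      _ = ε * (q * q) := by push_cast; ring
      _ ≤ ε * (q * m) := by gcongr
  · have hqs : (q : ℝ) ≤ √m := Real.le_sqrt_of_sq_le (by exact_mod_cast h)
    have hss : √(m : ℝ) * √m = m := Real.mul_self_sqrt hm0.le
    have hlog : Real.log m ^ 2 = 4 * Real.log √m ^ 2 := by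
      rw [Real.log_sqrt hm0.le]; ring
    rw [Real.norm_of_nonneg (by positivity), Real.norm_of_nonneg (by simp)] at hm
    simp only [id] at hm
    calc (P (12 * q) : ℝ) * Real.log m ^ 2
        ≤ (K * q ^ 2) * (4 * (ε / (4 * K) * √m)) := by
          rw [hlog]
          gcongr
          exact hK q hq
      _ = ε * (q * (q * √m)) := by field_simp
      _ ≤ ε * (q * (√m * √m)) := by gcongr
      _ = ε * (q * m) := by rw [hss]

/-- A monotone sequence has a small increment in every interval. -/
lemma exists_increment_le (hmono : Monotone P) {m : ℕ} (hm : 0 < m) (a : ℕ) :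
    ∃ n, a ≤ n ∧ n < a + m ∧ (P (n + 1) - P n) * m ≤ P (a + m) := by
  by_contra! h
  have hsum : ∑ i ∈ Finset.range m, (P (a + (i + 1)) - P (a + i)) = P (a + m) - P (a + 0) :=
    Finset.sum_range_tsub (f := fun i => P (a + i)) (fun i j hij => hmono (by omega)) m
  have hlt : ∑ i ∈ Finset.range m, P (a + m) <
      ∑ i ∈ Finset.range m, (P (a + (i + 1)) - P (a + i)) * m :=
    Finset.sum_lt_sum_of_nonempty (Finset.nonempty_range_iff.2 hm.ne') fun i hi =>
      h (a + i) (by omega) (by have := Finset.mem_range.1 hi; omega)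
  rw [← Finset.sum_mul, hsum, Finset.sum_const, Finset.card_range, smul_eq_mul, mul_comm] at hlt
  exact absurd hlt (not_lt.2 (Nat.mul_le_mul_right m (Nat.sub_le _ _)))

end Estimates

variable {A : Type*} [TopologicalSpace A] {X : Subshift A ℤ}

/-- The counting bound needs a positive range, hence the passage to `m + 1`. -/
lemma finite_autOfRange [Finite A] (X : Subshift A ℤ) (m : ℕ) : (autOfRange X m).Finite := by
  obtain ⟨S, hfin, hS, -⟩ := exists_isTestSet X (2 * (m + 1))
  exact (ncard_autOfRange_le m.succ_pos le_rfl hfin hS).1.subset (autOfRange_mono m.le_succ)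

/-- The number of automorphisms of range `m` grows subexponentially with `m`. -/
lemma eventually_ncard_autOfRange_le [Finite A]
    (hX : (fun n : ℕ => (complexity X n : ℝ)) =o[atTop]
      fun n : ℕ => (n : ℝ) ^ 2 / (Real.log n) ^ 2) {δ : ℝ} (hδ : 0 < δ) :
    ∀ᶠ m : ℕ in atTop, ((autOfRange X m).ncard : ℝ) ≤ Real.exp (δ * m) := by
  -- `14 = 7 * 2`: there are at most `7 ε m / log m` test points, each contributing `2 log m` to the
  -- exponent. The cap 1 gives `P(12m) ≤ m²`.
  set ε : ℝ := min 1 (δ / 14) with hεdef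
  have hε : 0 < ε := by positivity
  have hmono : Monotone (complexity X) := complexity_mono
  filter_upwards [eventually_forall_mul_log_sq_le hmono hX hε, eventually_ge_atTop 3]
    with m hm hm3
  have hm0 : (0 : ℝ) < m := by positivity
  have hlog : 1 ≤ Real.log m := by
    rw [Real.le_log_iff_exp_le hm0]
    exact Real.exp_one_lt_three.le.trans (by exact_mod_cast hm3)
  have hlog0 : 0 < Real.log m := by linarith
  have hlogsq : 1 ≤ Real.log m ^ 2 := one_le_pow₀ hlog
  set β : ℝ := ε * m / Real.log m ^ 2 with hβ
  have hβ0 : 0 ≤ β := by positivity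
  have hPm := hm m (by omega) le_rfl
  have hcm : ∀ c : ℕ, c * m ≤ complexity X (12 * m) → (c : ℝ) ≤ β := by
    intro c hc
    have h1 : (c : ℝ) * m ≤ complexity X (12 * m) := by exact_mod_cast hc
    rw [hβ, le_div_iff₀ (by positivity)]
    have h2 : ((c : ℝ) * m) * Real.log m ^ 2 ≤ ε * (m * m) :=
      (mul_le_mul_of_nonneg_right h1 (by positivity)).trans hPm
    refine le_of_mul_le_mul_right ?_ hm0
    linarith
  obtain ⟨n, hn1, hn2, hinc⟩ := exists_increment_le hmono (by omega : 0 < m) (4 * m)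
  have hD := hcm _ (hinc.trans (hmono (by omega)))
  have hle_sq : complexity X (12 * m) ≤ m ^ 2 := by
    have h1 : (complexity X (12 * m) : ℝ) * 1 ≤ complexity X (12 * m) * Real.log m ^ 2 := by
      gcongr
    have h2 : ε * (m * m) ≤ 1 * (m * m) := by
      gcongr
      exact min_le_left _ _
    have h3 : (complexity X (12 * m) : ℝ) ≤ (m : ℝ) ^ 2 := by linarith
    exact_mod_cast h3
  obtain ⟨S, hfin, hS, hcard⟩ := exists_isTestSet X n
  have hScard := hcard ⌊β⌋₊ fun j c h1 h2 => by
    refine Nat.le_floor ?_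
    -- Short periods use words of length `2 ^ (j + 2)`, long ones words of length `n`.
    rcases le_total (2 ^ j) m with hj | hj
    · have h3 := hm (2 ^ j) Nat.one_le_two_pow hj
      have h4 : c * 2 ^ j ≤ complexity X (12 * 2 ^ j) :=
        h2.trans (hmono (by rw [pow_add]; omega))
      have h5 : (c : ℝ) * 2 ^ j ≤ complexity X (12 * 2 ^ j) := by exact_mod_cast h4
      rw [hβ, le_div_iff₀ (by positivity)]
      refine le_of_mul_le_mul_right (a := (2 : ℝ) ^ j) ?_ (by positivity)
      have h6 := mul_le_mul_of_nonneg_right h5 (by positivity : 0 ≤ Real.log m ^ 2)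
      push_cast at h3
      linarith
    · exact hcm c ((Nat.mul_le_mul_left c hj).trans (h1.trans (hmono (by omega))))
  have hlog2 : ((Nat.log 2 (complexity X n) + 1 : ℕ) : ℝ) ≤ 5 * Real.log m := by
    have h1 : Nat.log 2 (complexity X n) ≤ Nat.log 2 (m ^ 2) :=
      Nat.log_mono_right ((hmono (by omega)).trans hle_sq)
    have h2 := Real.natLog_le_logb (m ^ 2) 2
    have h3 : Real.logb 2 ((m ^ 2 : ℕ) : ℝ) ≤ 4 * Real.log m := by
      push_cast
      rw [Real.logb, Real.log_pow, div_le_iff₀ (Real.log_pos one_lt_two)]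
      have := Real.log_two_gt_d9
      push_cast
      nlinarith
    have h4 : ((Nat.log 2 (complexity X n) : ℕ) : ℝ) ≤ (Nat.log 2 (m ^ 2) : ℕ) := by
      exact_mod_cast h1
    push_cast at h2 h3 h4 ⊢
    linarith
  have hS' : (S.ncard : ℝ) ≤ 7 * (ε * m / Real.log m) := by
    have h1 : (S.ncard : ℝ) ≤ 2 * β + 5 * Real.log m * β := by
      have h2 : (S.ncard : ℝ) ≤ 2 * ((complexity X (n + 1) - complexity X n : ℕ) : ℝ) +
          ((Nat.log 2 (complexity X n) + 1 : ℕ) : ℝ) * (⌊β⌋₊ : ℝ) := by exact_mod_cast hScard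
      refine h2.trans ?_
      gcongr
      exact Nat.floor_le hβ0
    have h2 : β * Real.log m = ε * m / Real.log m := by
      rw [hβ]; field_simp
    have h3 : β ≤ β * Real.log m := le_mul_of_one_le_right hβ0 hlog
    rw [← h2]
    linarith
  have hfinal := (ncard_autOfRange_le (m := m) (n := n) (by omega) (by omega) hfin hS).2
  have hpow : (autOfRange X m).ncard ≤ (m ^ 2) ^ S.ncard :=
    hfinal.trans (Nat.pow_le_pow_left ((hmono (by omega)).trans hle_sq) _)
  calc ((autOfRange X m).ncard : ℝ) ≤ ((m : ℝ) ^ 2) ^ S.ncard := by exact_mod_cast hpow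
    _ = Real.exp (S.ncard * (2 * Real.log m)) := by
      rw [Real.exp_nat_mul, two_mul, Real.exp_add, Real.exp_log hm0, sq]
    _ ≤ Real.exp (δ * m) := by
      rw [Real.exp_le_exp]
      calc (S.ncard : ℝ) * (2 * Real.log m)
          ≤ 7 * (ε * m / Real.log m) * (2 * Real.log m) := by gcongr
        _ = 14 * ε * m := by field_simp; ring
        _ ≤ δ * m := by
          have : ε ≤ δ / 14 := min_le_right _ _
          gcongr
          linarith

/-! ### Følner sequences from subexponential growth -/

/-- Otherwise every step of length `r` beyond `M` gains a factor `1 + ε`, and the growth is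
exponential. The proof uses steps of `r + 1`, so that they tend to infinity even for `r = 0`. -/
lemma exists_ratio_le {a : ℕ → ℕ} (hmono : Monotone a) (hpos : ∀ m, 0 < a m)
    (hexp : ∀ δ : ℝ, 0 < δ → ∀ᶠ m : ℕ in atTop, (a m : ℝ) ≤ Real.exp (δ * m))
    (r M : ℕ) {ε : ℝ} (hε : 0 < ε) : ∃ m ≥ M, (a (m + r) : ℝ) ≤ (1 + ε) * a m := by
  by_contra! h
  have hgrow : ∀ t : ℕ, (1 + ε) ^ t ≤ (a (M + t * (r + 1)) : ℝ) := by
    intro t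
    induction t with
    | zero => simpa using Nat.one_le_iff_ne_zero.2 (hpos M).ne'
    | succ t ih =>
      calc (1 + ε) ^ (t + 1) = (1 + ε) * (1 + ε) ^ t := by ring
        _ ≤ (1 + ε) * a (M + t * (r + 1)) := by gcongr
        _ ≤ a (M + t * (r + 1) + r) := (h _ (by omega)).le
        _ ≤ a (M + (t + 1) * (r + 1)) := by
          exact_mod_cast hmono (by rw [add_mul]; omega)
  set c := Real.log (1 + ε) with hc
  have hc0 : 0 < c := Real.log_pos (by linarith)
  -- Half the forced growth rate; the other half absorbs the offset `M` once `t > M`.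
  set δ := c / (2 * (r + 1)) with hδ
  have hδ0 : 0 < δ := by positivity
  have htend : Tendsto (fun t : ℕ => M + t * (r + 1)) atTop atTop :=
    tendsto_atTop_mono (fun t =>
      (Nat.le_mul_of_pos_right t r.succ_pos).trans (Nat.le_add_left _ _)) tendsto_id
  obtain ⟨t, ht, htM⟩ := ((htend.eventually (hexp δ hδ0)).and
    (eventually_gt_atTop M)).exists
  have h1 : Real.exp (c * t) ≤ Real.exp (δ * ((M + t * (r + 1) : ℕ) : ℝ)) := by
    refine le_trans (le_of_eq ?_) ((hgrow t).trans ht)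
    rw [Real.exp_mul, hc, Real.exp_log (by linarith), Real.rpow_natCast]
  rw [Real.exp_le_exp] at h1
  have h2 : δ * (2 * (r + 1)) = c := by rw [hδ]; field_simp
  have h3 : δ * ((M + t * (r + 1) : ℕ) : ℝ) = δ * M + c * t / 2 := by
    rw [← h2]; push_cast; ring
  have h4 : δ ≤ c / 2 := by
    rw [hδ]
    gcongr
    have : (0 : ℝ) ≤ r := by positivity
    linarith
  have h5 : (M : ℝ) < t := by exact_mod_cast htM
  have h6 : δ * M ≤ c / 2 * M := by gcongr
  have h7 : c / 2 * M < c / 2 * t := by gcongr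
  linarith

/-- A group exhausted by finite sets `H m` with `H a * H b ⊆ H (a + b)` whose size grows
subexponentially is amenable. -/
lemma isAmenable_of_subexponential {G : Type*} [Group G] {H : ℕ → Set G} (hmono : Monotone H)
    (hfin : ∀ m, (H m).Finite) (hone : ∀ m, 1 ∈ H m) (hcover : ∀ g, ∃ m, g ∈ H m)
    (hmul : ∀ {g h : G} {a b : ℕ}, g ∈ H a → h ∈ H b → g * h ∈ H (b + a))
    (hexp : ∀ δ : ℝ, 0 < δ → ∀ᶠ m : ℕ in atTop, ((H m).ncard : ℝ) ≤ Real.exp (δ * m)) :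
    IsAmenable G := by
  refine ⟨?_, ?_⟩
  · have huniv : ⋃ m, H m = Set.univ :=
      Set.eq_univ_of_forall fun g => Set.mem_iUnion.2 (hcover g)
    rw [← Set.countable_univ_iff, ← huniv]
    exact Set.countable_iUnion fun m => (hfin m).countable
  have hpos : ∀ m, 0 < (H m).ncard := fun m => (Set.ncard_pos (hfin m)).2 ⟨1, hone m⟩
  have hcardmono : Monotone fun m => (H m).ncard :=
    fun a b hab => Set.ncard_le_ncard (hmono hab) (hfin b)
  -- Diagonal choice: `k` bounds the range of the translating element, the radius from below, and
  -- the error.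
  choose μ hμ hratio using fun k : ℕ =>
    exists_ratio_le hcardmono hpos hexp k k (ε := 1 / ((k : ℝ) + 1)) (by positivity)
  refine ⟨fun k => H (μ k), fun k => hfin _, fun g => ?_, fun g => ?_⟩
  · obtain ⟨r, hr⟩ := hcover g
    filter_upwards [eventually_ge_atTop r] with k hk
    exact hmono (hk.trans (hμ k)) hr
  obtain ⟨r, hr⟩ := hcover g
  have hlim : Tendsto (fun k : ℕ => 2 * (1 / ((k : ℝ) + 1))) atTop (𝓝 0) := by
    simpa using tendsto_one_div_add_atTop_nhds_zero_nat.const_mul (2 : ℝ)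
  refine tendsto_of_tendsto_of_tendsto_of_le_of_le' tendsto_const_nhds hlim
    (Eventually.of_forall fun k => by positivity) ?_
  filter_upwards [eventually_ge_atTop r] with k hk
  set F := H (μ k) with hF
  set F' := H (μ k + k) with hF'
  have hFF' : F ⊆ F' := hmono (by omega)
  have hgF : g • F ⊆ F' := by
    rintro _ ⟨f, hf, rfl⟩
    exact hmono (by omega) (hmul hr hf)
  have hFfin : F.Finite := hfin _
  have hF'fin : F'.Finite := hfin _
  have hgcard : (g • F).ncard = F.ncard := Set.ncard_image_of_injective F (MulAction.injective g)
  have h1 : (F' \ F).ncard + F.ncard = F'.ncard :=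
    Set.ncard_sdiff_add_ncard_of_subset hFF' hF'fin
  have h2 : (F' \ (g • F)).ncard + (g • F).ncard = F'.ncard :=
    Set.ncard_sdiff_add_ncard_of_subset hgF hF'fin
  -- `F` and `g • F` have equal size inside `F'`, so the difference has at most `2 (|F'| - |F|)`
  -- elements.
  have h3 : F ∆ (g • F) ⊆ (F' \ (g • F)) ∪ (F' \ F) := by
    rintro x (⟨hx, hx'⟩ | ⟨hx, hx'⟩)
    · exact Or.inl ⟨hFF' hx, hx'⟩
    · exact Or.inr ⟨hgF hx, hx'⟩
  have h4 : (F ∆ (g • F)).ncard ≤ (F' \ (g • F)).ncard + (F' \ F).ncard :=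
    (Set.ncard_le_ncard h3 (hF'fin.subset (Set.union_subset Set.sdiff_subset
      Set.sdiff_subset))).trans (Set.ncard_union_le _ _)
  have h5 : ((F ∆ (g • F)).ncard : ℝ) + 2 * F.ncard ≤ 2 * F'.ncard := by
    exact_mod_cast (by omega : (F ∆ (g • F)).ncard + 2 * F.ncard ≤ 2 * F'.ncard)
  have h6 := hratio k
  have hFpos : (0 : ℝ) < F.ncard := by exact_mod_cast hpos (μ k)
  rw [div_le_iff₀ hFpos]
  change (F'.ncard : ℝ) ≤ (1 + 1 / ((k : ℝ) + 1)) * F.ncard at h6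
  linarith

end SlowGrowth

theorem theorem1 {A : Type*} [Finite A] [TopologicalSpace A] [DiscreteTopology A]
    (X : Subshift A ℤ)
    (hX : (fun n : ℕ => (complexity X n : ℝ)) =o[atTop]
      fun n : ℕ => (n : ℝ) ^ 2 / (Real.log n) ^ 2) :
    IsAmenable (Aut X) :=
  SlowGrowth.isAmenable_of_subexponential SlowGrowth.autOfRange_mono
    (SlowGrowth.finite_autOfRange X) SlowGrowth.one_mem_autOfRange
    SlowGrowth.exists_mem_autOfRange SlowGrowth.mul_mem_autOfRange
    fun _ hδ => SlowGrowth.eventually_ncard_autOfRange_le hX hδ
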